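/- Let $\Gamma$ be a finite set with $N=\operatorname{card}(\Gamma)\ge 2$. The Dyck inverse monoid over $\Gamma$ is the monoid with zero generated by the symbols $\gamma(-),\gamma(+)$, $\gamma\in\Gamma$, subject to the relations $\gamma(-)\gamma(+)=\mathbf 1$ and $\gamma(-)\gamma'(+)=0$ for $\gamma\ne\gamma'$. The Dyck shift $D_N$ is the set of bi-infinite sequences over the alphabet $\{\gamma(-),\gamma(+):\gamma\in\Gamma\}$ all of whose finite subwords have a nonzero product in this monoid. Let $1\le K\le N$, and let $\Psi$ assign to every $\gamma\in\Gamma$ a subset $\Psi(\gamma)\subset\Gamma$ with $\operatorname{card}(\Psi(\gamma))=K$. Let $X_\Psi$ be the subshift of all points of $D_N$ in which none of the words $\beta(+)\alpha(+)$, $\alpha,\beta\in\Gamma$, $\beta\notin\Psi(\alpha)$, appears. Let the matrix $A_\Psi$, indexed by $\Gamma\times\Gamma$, be given by $A_\Psi(\beta,\alpha)=1$ if $\beta\in\Psi(\alpha)$ and $A_\Psi(\beta,\alpha)=0$ otherwise. For a shift invariant set $Y$ of bi-infinite sequences let $$\zeta_Y(z)=\exp\Big(\sum_{n\ge1}\frac{\operatorname{card}(P_n(Y))}{n}z^n\Big),$$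 where $P_n(Y)$ is the set of points of $Y$ that are fixed by the $n$-th power of the shift $(x_i)_{i\in\mathbb Z}\mapsto(x_{i+1})_{i\in\mathbb Z}$. Put $$g(z)=\tfrac12\Big(1+(N-K)z^2-\sqrt{(1+(N-K)z^2)^2-4Nz^2}\,\Big),$$ where the square root is the power series with constant coefficient $1$. Then, as formal power series in $z$ with rational coefficients, $$\zeta_{X_\Psi}(z)=\frac{(1-Kz)(1-g(z))}{\det(\mathbf 1-A_\Psi z)\,(1-Nz-g(z))\,(1-Kz-g(z))}.$$ -/

import Mathlib

open PowerSeries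

noncomputable section

/-- The alphabet of the Dyck shift: the symbols `γ(-)` and `γ(+)` for `γ ∈ Γ`. -/
inductive DyckLetter (Γ : Type*) where
  | neg (γ : Γ) : DyckLetter Γ
  | pos (γ : Γ) : DyckLetter Γ

/-- The defining relations of the Dyck inverse monoid (polycyclic monoid), on the free monoid
with zero over the symbols: `γ(-) γ(+) = 1`, and `γ(-) γ'(+) = 0` for `γ ≠ γ'`. -/
inductive DyckRel (Γ : Type*) :
    WithZero (FreeMonoid (DyckLetter Γ)) → WithZero (FreeMonoid (DyckLetter Γ)) → Prop where
  | same (γ : Γ) : DyckRel Γ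
      ((FreeMonoid.of (DyckLetter.neg γ) * FreeMonoid.of (DyckLetter.pos γ) :
        FreeMonoid (DyckLetter Γ)) : WithZero (FreeMonoid (DyckLetter Γ))) 1
  | diff (γ γ' : Γ) (h : γ ≠ γ') : DyckRel Γ
      ((FreeMonoid.of (DyckLetter.neg γ) * FreeMonoid.of (DyckLetter.pos γ') :
        FreeMonoid (DyckLetter Γ)) : WithZero (FreeMonoid (DyckLetter Γ))) 0

/-- The Dyck inverse monoid over `Γ`: the monoid with zero that is generated by the symbols
`γ(-)`, `γ(+)` subject to the relations `DyckRel`. -/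
def DyckMonoid (Γ : Type*) : Type _ := (conGen (DyckRel Γ)).Quotient

instance DyckMonoid.instMonoid (Γ : Type*) : Monoid (DyckMonoid Γ) :=
  inferInstanceAs (Monoid (conGen (DyckRel Γ)).Quotient)

/-- The quotient map from the free monoid with zero. -/
def DyckMonoid.mk (Γ : Type*) : WithZero (FreeMonoid (DyckLetter Γ)) →* DyckMonoid Γ :=
  (conGen (DyckRel Γ)).mk'

instance DyckMonoid.instZero (Γ : Type*) : Zero (DyckMonoid Γ) := ⟨DyckMonoid.mk Γ 0⟩

/-- The element of the Dyck inverse monoid that is given by a symbol. -/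
def DyckMonoid.gen {Γ : Type*} (a : DyckLetter Γ) : DyckMonoid Γ :=
  DyckMonoid.mk Γ ((FreeMonoid.of a : FreeMonoid (DyckLetter Γ)) :
    WithZero (FreeMonoid (DyckLetter Γ)))

/-- The word `x_i x_{i+1} … x_{i+n-1}` that appears in the point `x` at position `i`. -/
def subwordAt {A : Type*} (x : ℤ → A) (i : ℤ) (n : ℕ) : List A :=
  (List.range n).map fun j => x (i + (j : ℤ))

/-- The Dyck shift over `Γ`: the bi-infinite sequences all of whose finite subwords have a
nonzero product in the Dyck inverse monoid. -/
def dyckShift (Γ : Type*) : Set (ℤ → DyckLetter Γ) :=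
  {x | ∀ (i : ℤ) (n : ℕ), ((subwordAt x i n).map DyckMonoid.gen).prod ≠ 0}

/-- The subshift `X_Ψ`: the points of the Dyck shift in which none of the words `β(+) α(+)`,
`β ∉ Ψ α`, appears. -/
def dyckShiftRemoved {Γ : Type*} (Ψ : Γ → Finset Γ) : Set (ℤ → DyckLetter Γ) :=
  {x | x ∈ dyckShift Γ ∧ ∀ α β : Γ, β ∉ Ψ α → ∀ i : ℤ,
    subwordAt x i 2 ≠ [DyckLetter.pos β, DyckLetter.pos α]}

/-- The zeta function `exp (∑_{n ≥ 1} card (P_n Y) z ^ n / n)` of a set `Y` of bi-infinite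
sequences, as a formal power series; `P_n Y` is the set of `y ∈ Y` that are fixed by the `n`-th
power of the shift `(x_i) ↦ (x_{i+1})`. -/
def shiftZeta {A : Type*} (Y : Set (ℤ → A)) : ℚ⟦X⟧ :=
  (PowerSeries.exp ℚ).subst (PowerSeries.mk fun n : ℕ =>
    if n = 0 then (0 : ℚ)
    else ((Y ∩ Function.ptsOfPeriod
      (SymbolicDynamics.FullShift.shift (1 : ℤ)) n).ncard : ℚ) / (n : ℚ))

/-- The square root of a power series `f` with constant coefficient `1`: the binomial series
`(1 + X) ^ (1/2)` with `f - 1` substituted for `X`. -/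
def seriesSqrt (f : ℚ⟦X⟧) : ℚ⟦X⟧ := (PowerSeries.binomialSeries ℚ (1 / 2 : ℚ)).subst (f - 1)

theorem hasSubst_sub_one {f : ℚ⟦X⟧} (hf : constantCoeff f = 1) : HasSubst (f - 1) :=
  HasSubst.of_constantCoeff_zero' (by simp [hf])

/-- `seriesSqrt f` is a square root of `f`. -/
theorem seriesSqrt_sq {f : ℚ⟦X⟧} (hf : constantCoeff f = 1) : seriesSqrt f ^ 2 = f := by
  have h := hasSubst_sub_one hf
  have h1 : PowerSeries.binomialSeries ℚ (1 / 2 : ℚ) ^ 2 = 1 + X := by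
    have h2 := PowerSeries.binomialSeries_nat (R := ℚ) (A := ℚ) 1
    have h3 := PowerSeries.binomialSeries_add (R := ℚ) (A := ℚ) (1 / 2) (1 / 2)
    rw [sq, ← h3]
    norm_num at h2 ⊢
    exact h2
  unfold seriesSqrt
  rw [← subst_pow h, h1, ← coe_substAlgHom h, map_add, map_one, coe_substAlgHom h, subst_X h]
  ring

/-- `seriesSqrt f` has constant coefficient `1`. -/
theorem constantCoeff_seriesSqrt {f : ℚ⟦X⟧} (hf : constantCoeff f = 1) :
    constantCoeff (seriesSqrt f) = 1 := by
  have h := hasSubst_sub_one hf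
  have h0 : constantCoeff (f - 1) = 0 := by simp [hf]
  have h1 : PowerSeries.binomialSeries ℚ (1 / 2 : ℚ) = 1 + (PowerSeries.binomialSeries ℚ (1 / 2 : ℚ) - 1) := by ring
  have h2 : constantCoeff ((PowerSeries.binomialSeries ℚ (1 / 2 : ℚ) - 1).subst (f - 1) : ℚ⟦X⟧) = 0 :=
    constantCoeff_subst_eq_zero (a := f - 1) h0 _ (by simp)
  unfold seriesSqrt
  rw [h1, ← coe_substAlgHom h, map_add, map_one, coe_substAlgHom h, map_add]
  have h3 : constantCoeff (1 : ℚ⟦X⟧) = 1 := map_one _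
  erw [h2, h3]
  simp

/-- The power series `g(z) = ½ (1 + (N - K) z² - √((1 + (N - K) z²)² - 4 N z²))`; the radicand has
constant coefficient `1`. -/
def gSeries (N K : ℕ) : ℚ⟦X⟧ :=
  C (1 / 2 : ℚ) * (1 + ((N : ℚ⟦X⟧) - (K : ℚ⟦X⟧)) * X ^ 2 -
    seriesSqrt ((1 + ((N : ℚ⟦X⟧) - (K : ℚ⟦X⟧)) * X ^ 2) ^ 2 - 4 * (N : ℚ⟦X⟧) * X ^ 2))

/-- The transition matrix `A_Ψ`, with `A_Ψ(β, α) = 1` if `β ∈ Ψ α` and `0` otherwise. -/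
def transitionMatrix {Γ : Type*} [DecidableEq Γ] (Ψ : Γ → Finset Γ) : Matrix Γ Γ ℚ⟦X⟧ :=
  Matrix.of fun β α => if β ∈ Ψ α then 1 else 0

end

noncomputable section

/-! Read `γ(-)` as an opening bracket (height step +1) and `γ(+)` as a closing one (height step -1).
A sequence lies in the Dyck shift exactly when matching brackets carry equal labels
(`mem_dyckShift_iff`).

For a point of period n, forget the labels of the opening brackets. On the remaining skeleton the
forbidden words are still visible, matched opening brackets have forced labels, and unmatched ones
are free. If h is the height gained over a period, there are max(h, 0) unmatched ones per period
(`card_unmatched`). So the number of points is the sum of N ^ max(h, 0) over the allowed cyclic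
skeletons (`ncard_periodic`).

A transfer matrix M over Laurent polynomials records h as the exponent of T, and the linear
functional φ with φ(T^h) = N ^ max(h, 0) turns tr(M^n) into the point count. Since the traces
generate -(log det(1 - zM))', the logarithmic derivative of zeta is the image of this series under
φ. The functional is not multiplicative, but it is evaluation at T = N on polynomials in T, and at
T⁻¹ = 1 on polynomials in T⁻¹.

It thus suffices to factor the determinant into parts of these two kinds. Constant column sums K
reduce it to det(1 - zT⁻¹A) and (1 - zT)(1 - KzT⁻¹) - Nz² (`Matrix.det_oneSubX_bordered`), and the
latter equals c(1 - aT)(1 - KaT⁻¹) with c = 1 - g and a = z/c. This is the source of the quadratic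
equation for g. -/

/-! ### Jacobi's formula and logarithmic derivatives -/

theorem Derivation.leibniz_finset_prod {R S ι : Type*} [CommRing R] [CommRing S] [Algebra R S]
    [DecidableEq ι] (D : Derivation R S S) (s : Finset ι) (f : ι → S) :
    D (∏ i ∈ s, f i) = ∑ i ∈ s, (∏ j ∈ s.erase i, f j) * D (f i) := by
  induction s using Finset.induction_on with
  | empty => simp
  | insert a s ha ih =>
    rw [Finset.prod_insert ha, D.leibniz, ih, Finset.sum_insert ha, Finset.erase_insert ha,
      smul_eq_mul, smul_eq_mul, add_comm, Finset.mul_sum]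
    congr 1
    refine Finset.sum_congr rfl fun i hi => ?_
    have hia : i ≠ a := fun h => ha (h ▸ hi)
    rw [Finset.erase_insert_of_ne hia.symm, Finset.prod_insert (by simp [ha]), mul_assoc]

/-- Jacobi's formula. -/
theorem Derivation.det_eq_trace {R S ι : Type*} [CommRing R] [CommRing S] [Algebra R S]
    [Fintype ι] [DecidableEq ι] (D : Derivation R S S) (M : Matrix ι ι S) :
    D M.det = (M.adjugate * M.map D).trace := by
  have h1 : (M.adjugate * M.map D).trace
      = ∑ i, (M.updateCol i fun k => D (M k i)).det := by
    simp only [Matrix.trace, Matrix.diag_apply]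
    refine Finset.sum_congr rfl fun i _ => ?_
    rw [← Matrix.cramer_apply, Matrix.cramer_eq_adjugate_mulVec]
    rfl
  rw [h1, Matrix.det_apply, map_sum]
  simp only [Matrix.det_apply]
  rw [Finset.sum_comm]
  refine Finset.sum_congr rfl fun σ _ => ?_
  rw [← Finset.smul_sum, Units.smul_def, Units.smul_def, map_zsmul, D.leibniz_finset_prod]
  congr 1
  refine Finset.sum_congr rfl fun i _ => ?_
  rw [← Finset.mul_prod_erase Finset.univ _ (Finset.mem_univ i), mul_comm]
  congr 1
  · simp
  · refine Finset.prod_congr rfl fun j hj => ?_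
    rw [Matrix.updateCol_ne (Finset.ne_of_mem_erase hj)]

namespace PowerSeries

/-- The logarithmic derivative of a power series with constant coefficient `1`. -/
def ld {R : Type*} [CommRing R] (u : R⟦X⟧) : R⟦X⟧ := d⁄dX R u * invOfUnit u 1

section ld
variable {R : Type*} [CommRing R]

theorem ld_mul_self {u : R⟦X⟧} (hu : constantCoeff u = 1) : ld u * u = d⁄dX R u := by
  rw [ld, mul_assoc, mul_comm _ u, mul_invOfUnit u 1 (by simpa using hu), mul_one]

theorem eq_ld_of_mul {u v : R⟦X⟧} (hu : constantCoeff u = 1) (h : v * u = d⁄dX R u) :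
    v = ld u := by
  rw [ld, ← h, mul_assoc, mul_invOfUnit u 1 (by simpa using hu), mul_one]

theorem ld_mul {u v : R⟦X⟧} (hu : constantCoeff u = 1) (hv : constantCoeff v = 1) :
    ld (u * v) = ld u + ld v := by
  refine (eq_ld_of_mul (by simp [hu, hv]) ?_).symm
  rw [Derivation.leibniz, smul_eq_mul, smul_eq_mul, ← ld_mul_self hu, ← ld_mul_self hv]
  ring

theorem derivative_map {S : Type*} [CommRing S] (f : R →+* S) (u : R⟦X⟧) :
    d⁄dX S (map f u) = map f (d⁄dX R u) := by
  ext n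
  simp [coeff_derivative]

theorem ld_map {S : Type*} [CommRing S] (f : R →+* S) {u : R⟦X⟧} (hu : constantCoeff u = 1) :
    ld (map f u) = map f (ld u) := by
  refine (eq_ld_of_mul ?_ ?_).symm
  · rw [← coeff_zero_eq_constantCoeff_apply, coeff_map, coeff_zero_eq_constantCoeff_apply, hu,
      map_one]
  · rw [← map_mul, ld_mul_self hu, derivative_map]

/-- The quotient of u and v has logarithmic derivative 0, hence derivative 0; without additive
torsion it is constant. -/
theorem eq_of_ld_eq [IsAddTorsionFree R] {u v : R⟦X⟧} (hu : constantCoeff u = 1)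
    (hv : constantCoeff v = 1) (h : ld u = ld v) : u = v := by
  have hw : v * invOfUnit v 1 = 1 := mul_invOfUnit v 1 (by simpa using hv)
  set w := invOfUnit v 1
  have hw1 : constantCoeff w = 1 := by
    have := congrArg constantCoeff hw
    simpa [hv] using this
  have h1 : ld (u * w) = 0 := by
    have h2 : ld (v * w) = 0 := by rw [hw]; simp [ld]
    rw [ld_mul hv hw1] at h2
    rw [ld_mul hu hw1, h, h2]
  have h3 : u * w = 1 := by
    refine derivative.ext ?_ (by simp [hu, hw1])
    rw [← ld_mul_self (by simp [hu, hw1]), h1, derivative_one, zero_mul]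
  calc u = u * (v * w) := by rw [hw, mul_one]
    _ = v * (u * w) := by ring
    _ = v := by rw [h3, mul_one]

end ld

end PowerSeries

/-! ### Traces of matrix powers -/

namespace Matrix
variable {R ι : Type*} [CommRing R] [Fintype ι] [DecidableEq ι]

/-- The matrix `1 - X • M` over power series. -/
def oneSubX (M : Matrix ι ι R) : Matrix ι ι R⟦X⟧ := 1 - (X : R⟦X⟧) • M.map (C (R := R))

theorem constantCoeff_det_oneSubX (M : Matrix ι ι R) : constantCoeff (oneSubX M).det = 1 := by
  rw [RingHom.map_det, show (constantCoeff (R := R)).mapMatrix (oneSubX M) = 1 from ?_, det_one]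
  ext i j
  rcases eq_or_ne i j with rfl | hij
  · simp [oneSubX]
  · simp [oneSubX, hij]

/-- The geometric series G inverts 1 - XM, so the adjugate is the determinant times G, and Jacobi's
formula expresses the derivative of the determinant through the trace of GM. -/
theorem trace_pow_series (M : Matrix ι ι R) :
    (PowerSeries.mk fun m => (M ^ (m + 1)).trace) = - ld (oneSubX M).det := by
  rw [eq_comm, neg_eq_iff_eq_neg, eq_comm]
  refine eq_ld_of_mul (constantCoeff_det_oneSubX M) ?_
  set G : Matrix ι ι R⟦X⟧ := Matrix.of fun i j => PowerSeries.mk fun m => (M ^ m) i j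
  have hG : oneSubX M * G = 1 := by
    ext i j n
    rw [oneSubX, Matrix.sub_mul, Matrix.one_mul, Matrix.smul_mul]
    simp only [sub_apply, smul_apply, map_sub, smul_eq_mul]
    rcases n with _ | n
    · rcases eq_or_ne i j with rfl | hij
      · simp [G]
      · simp [G, hij]
    · have : coeff (n + 1) ((1 : Matrix ι ι R⟦X⟧) i j) = 0 := by
        rcases eq_or_ne i j with rfl | hij
        · simp [coeff_one]
        · simp [hij]
      simp [G, coeff_succ_X_mul, this, pow_succ', mul_apply]
  have hadj : (oneSubX M).adjugate = (oneSubX M).det • G := by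
    rw [← mul_one (oneSubX M).adjugate, ← hG, ← mul_assoc, adjugate_mul, smul_mul, one_mul]
  have hD : (oneSubX M).map (d⁄dX R) = - M.map (C (R := R)) := by
    ext i j : 2
    rcases eq_or_ne i j with rfl | hij
    · simp [oneSubX]
    · simp [oneSubX, hij]
  rw [Derivation.det_eq_trace, hadj, hD, smul_mul, trace_smul, smul_eq_mul, mul_neg, trace_neg,
    mul_comm, mul_neg, mul_neg]
  congr 2
  ext n
  simp [G, trace, pow_succ, mul_apply]

theorem pow_succ_apply_eq_sum (M : Matrix ι ι R) (m : ℕ) (a b : ι) :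
    (M ^ (m + 1)) a b = ∑ f : Fin m → ι, ∏ i : Fin (m + 1),
      M ((Fin.cons a f : Fin (m + 1) → ι) i) ((Fin.snoc f b : Fin (m + 1) → ι) i) := by
  induction m generalizing a with
  | zero => simp [Fin.snoc]
  | succ m ih =>
    rw [pow_succ', mul_apply, ← Fintype.sum_equiv (Fin.consEquiv fun _ => ι) _ _ fun _ => rfl,
      Fintype.sum_prod_type]
    refine Finset.sum_congr rfl fun x _ => ?_
    rw [ih, Finset.mul_sum]
    refine Finset.sum_congr rfl fun g _ => ?_
    change _ = ∏ i, M ((Fin.cons a (Fin.cons x g : Fin (m + 1) → ι) : Fin (m + 2) → ι) i)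
      ((Fin.snoc (Fin.cons x g : Fin (m + 1) → ι) b : Fin (m + 2) → ι) i)
    rw [← Fin.cons_snoc_eq_snoc_cons, Fin.prod_univ_succ (n := m + 1)]
    simp only [Fin.cons_succ, Fin.cons_zero]

/-- The trace of a power as a sum over cyclic sequences. -/
theorem trace_pow_succ (M : Matrix ι ι R) (m : ℕ) :
    (M ^ (m + 1)).trace = ∑ c : Fin (m + 1) → ι, ∏ i, M (c i) (c (i + 1)) := by
  rw [trace, ← Fintype.sum_equiv (Fin.consEquiv fun _ => ι) _ _ fun _ => rfl,
    Fintype.sum_prod_type]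
  refine Finset.sum_congr rfl fun a _ => ?_
  rw [diag_apply, pow_succ_apply_eq_sum]
  refine Finset.sum_congr rfl fun f _ => Finset.prod_congr rfl fun i _ => ?_
  congr 1
  induction i using Fin.lastCases with
  | last => simp
  | cast i => simp

end Matrix

/-! ### The Dyck monoid acting on functions of stacks -/

namespace DyckLetter
variable {Γ : Type*}

/-- The symbol of a letter, forgetting its sign. -/
def label : DyckLetter Γ → Γ
  | neg γ => γ
  | pos γ => γ

/-- The height increment of a letter: `γ(-)` opens a bracket, `γ(+)` closes one. -/
def sgn : DyckLetter Γ → ℤ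
  | neg _ => 1
  | pos _ => -1

end DyckLetter

namespace DyckMonoid
variable {Γ : Type*}

theorem zero_mul' (a : DyckMonoid Γ) : 0 * a = 0 := by
  obtain ⟨b, rfl⟩ := Con.mk'_surjective a
  exact (map_mul (mk Γ) 0 b).symm.trans (by rw [zero_mul]; rfl)

theorem mul_zero' (a : DyckMonoid Γ) : a * 0 = 0 := by
  obtain ⟨b, rfl⟩ := Con.mk'_surjective a
  exact (map_mul (mk Γ) b 0).symm.trans (by rw [mul_zero]; rfl)

theorem gen_neg_mul_gen_pos (γ : Γ) :
    gen (DyckLetter.neg γ) * gen (DyckLetter.pos γ) = (1 : DyckMonoid Γ) := by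
  have h := (Con.eq (conGen (DyckRel Γ))).2 (ConGen.Rel.of _ _ (DyckRel.same γ))
  rw [gen, gen, ← map_mul, ← WithZero.coe_mul, ← map_one (mk Γ)]
  exact h

theorem gen_neg_mul_gen_pos_of_ne {γ γ' : Γ} (hne : γ ≠ γ') :
    gen (DyckLetter.neg γ) * gen (DyckLetter.pos γ') = (0 : DyckMonoid Γ) := by
  have h := (Con.eq (conGen (DyckRel Γ))).2 (ConGen.Rel.of _ _ (DyckRel.diff γ γ' hne))
  rw [gen, gen, ← map_mul, ← WithZero.coe_mul]
  exact h

/-- The stack `σ` with `γ` on top. -/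
def push (γ : Γ) (σ : ℕ → Γ) : ℕ → Γ
  | 0 => γ
  | k + 1 => σ k

/-- The action of a letter on functions on infinite stacks: `γ(-)` pushes `γ`, and `γ(+)` pops
`γ` and is zero where the top is different. -/
def letterAction (a : DyckLetter Γ) : Module.End ℚ ((ℕ → Γ) → ℚ) := by
  classical
  exact match a with
  | .neg γ => LinearMap.funLeft ℚ ℚ fun σ => push γ σ
  | .pos γ =>
    { toFun := fun f σ => if σ 0 = γ then f (fun k => σ (k + 1)) else 0
      map_add' := fun f g => by ext σ; by_cases h : σ 0 = γ <;> simp [h]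
      map_smul' := fun c f => by ext σ; by_cases h : σ 0 = γ <;> simp [h] }

theorem letterAction_neg (γ : Γ) (f : (ℕ → Γ) → ℚ) (σ : ℕ → Γ) :
    letterAction (.neg γ) f σ = f (push γ σ) := rfl

theorem letterAction_pos_of_eq {γ : Γ} (f : (ℕ → Γ) → ℚ) {σ : ℕ → Γ} (h : σ 0 = γ) :
    letterAction (.pos γ) f σ = f (fun k => σ (k + 1)) := by
  simp [letterAction, h]

theorem letterAction_pos_of_ne {γ : Γ} (f : (ℕ → Γ) → ℚ) {σ : ℕ → Γ} (h : σ 0 ≠ γ) :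
    letterAction (.pos γ) f σ = 0 := by
  simp [letterAction, h]

/-- The action of the free monoid with zero on functions on infinite stacks. -/
def freeAction (Γ : Type*) :
    WithZero (FreeMonoid (DyckLetter Γ)) →*₀ Module.End ℚ ((ℕ → Γ) → ℚ) :=
  WithZero.lift' (FreeMonoid.lift letterAction)

theorem freeAction_of (a : DyckLetter Γ) :
    freeAction Γ ((FreeMonoid.of a : FreeMonoid (DyckLetter Γ)) :
      WithZero (FreeMonoid (DyckLetter Γ))) = letterAction a := by
  rw [freeAction, WithZero.lift'_coe, FreeMonoid.lift_eval_of]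

/-- The action of the Dyck monoid on functions on infinite stacks. -/
def action (Γ : Type*) : DyckMonoid Γ →* Module.End ℚ ((ℕ → Γ) → ℚ) :=
  (conGen (DyckRel Γ)).lift (freeAction Γ : WithZero (FreeMonoid (DyckLetter Γ)) →* _) <| by
    rw [Con.conGen_le]
    rintro _ _ (⟨γ⟩ | ⟨γ, γ', h⟩)
    · rw [Con.ker_rel]
      simp only [MonoidHom.coe_coe, WithZero.coe_mul, map_mul, map_one, freeAction_of]
      ext f σ
      rw [Module.End.mul_apply, letterAction_neg, letterAction_pos_of_eq _ (by rfl)]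
      rfl
    · rw [Con.ker_rel]
      simp only [MonoidHom.coe_coe, WithZero.coe_mul, map_mul, map_zero, freeAction_of]
      ext f σ
      rw [Module.End.mul_apply, letterAction_neg, letterAction_pos_of_ne _ (by exact h)]
      rfl

theorem action_gen (a : DyckLetter Γ) : action Γ (gen a) = letterAction a := by
  rw [← freeAction_of]
  exact Con.lift_mk' _ _

theorem action_zero : action Γ 0 = 0 := by
  have : action Γ (mk Γ 0) = freeAction Γ 0 := Con.lift_mk' _ _
  rw [(freeAction Γ).map_zero] at this
  exact this

end DyckMonoid

/-! ### Bracket matching and membership in the Dyck shift -/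

/-- The path `H` returns to the height `H i` for the first time at `j > i`, staying above it
in between. -/
def FirstReturn (H : ℤ → ℤ) (i j : ℤ) : Prop :=
  i < j ∧ H j = H i ∧ ∀ k, i < k → k < j → H i < H k

theorem subwordAt_eq_map {A : Type*} (x : ℤ → A) (i : ℤ) (n : ℕ) :
    subwordAt x i n = (List.range n).map fun j : ℕ => x (i + j) := by
  simp [subwordAt, ← List.map_eq_flatMap, Function.comp_def]

theorem subwordAt_succ {A : Type*} (x : ℤ → A) (i : ℤ) (n : ℕ) :
    subwordAt x i (n + 1) = x i :: subwordAt x (i + 1) n := by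
  rw [subwordAt_eq_map, subwordAt_eq_map, List.range_succ_eq_map, List.map_cons, List.map_map]
  refine congrArg₂ _ (by simp) (List.map_congr_left fun k _ => ?_)
  simp only [Function.comp_apply, Nat.cast_succ]
  congr 1
  ring

theorem subwordAt_succ' {A : Type*} (x : ℤ → A) (i : ℤ) (n : ℕ) :
    subwordAt x i (n + 1) = subwordAt x i n ++ [x (i + n)] := by
  simp [subwordAt_eq_map, List.range_succ]

section dyck
variable {Γ : Type*} {x : ℤ → DyckLetter Γ} {H : ℤ → ℤ}

/-- While the path stays at or above its initial height, every closing letter meets an uncancelled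
opening letter, so it cancels that letter or makes the product zero. -/
theorem prod_subwordAt_of_le (hH : ∀ i, H (i + 1) = H i + (x i).sgn) (i : ℤ) (m : ℕ)
    (h : ∀ k : ℕ, k ≤ m → H i ≤ H (i + k)) :
    ((subwordAt x i m).map DyckMonoid.gen).prod = 0 ∨
    ∃ v : List Γ, (v.length : ℤ) = H (i + m) - H i ∧
      ((subwordAt x i m).map DyckMonoid.gen).prod =
        (v.map fun γ => DyckMonoid.gen (DyckLetter.neg γ)).prod := by
  induction m with
  | zero => exact Or.inr ⟨[], by simp, by simp [subwordAt]⟩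
  | succ m ih =>
    have hs := hH (i + m)
    have hm1 := h (m + 1) le_rfl
    push_cast at hm1 ⊢
    rw [← add_assoc] at hm1 ⊢
    rw [hs] at hm1 ⊢
    rw [subwordAt_succ', List.map_append, List.prod_append]
    rcases ih fun k hk => h k (by omega) with h0 | ⟨v, hv, hp⟩
    · left
      rw [h0, DyckMonoid.zero_mul']
    rw [hp]
    rcases hx : x (i + m) with γ | γ
    · right
      refine ⟨v ++ [γ], ?_, by simp⟩
      simp [DyckLetter.sgn, hv]
      ring
    · simp only [hx, DyckLetter.sgn] at hm1
      rcases v.eq_nil_or_concat' with rfl | ⟨v', γ', rfl⟩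
      · simp at hv
        omega
      · by_cases hγ : γ' = γ
        · right
          refine ⟨v', ?_, ?_⟩
          · simp [DyckLetter.sgn] at hv ⊢
            linarith
          · simp [mul_assoc, hγ, DyckMonoid.gen_neg_mul_gen_pos]
        · left
          simp [mul_assoc, DyckMonoid.gen_neg_mul_gen_pos_of_ne hγ, DyckMonoid.mul_zero']

theorem sgn_eq_of_lt {a : DyckLetter Γ} (h : 0 < a.sgn) : a = .neg a.label := by
  cases a
  · rfl
  · simp [DyckLetter.sgn] at h

theorem sgn_eq_of_gt {a : DyckLetter Γ} (h : a.sgn < 0) : a = .pos a.label := by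
  cases a
  · simp [DyckLetter.sgn] at h
  · rfl

theorem sgn_ne_zero (a : DyckLetter Γ) : a.sgn ≠ 0 := by
  cases a <;> simp [DyckLetter.sgn]

theorem FirstReturn.add_two_le (hH : ∀ i, H (i + 1) = H i + (x i).sgn) {i j : ℤ}
    (h : FirstReturn H i j) : i + 2 ≤ j := by
  obtain ⟨h1, h2, _⟩ := h
  by_contra hc
  obtain rfl : j = i + 1 := by omega
  have := hH i
  have := sgn_ne_zero (x i)
  omega

theorem FirstReturn.eq_neg (hH : ∀ i, H (i + 1) = H i + (x i).sgn) {i j : ℤ}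
    (h : FirstReturn H i j) : x i = .neg (x i).label := by
  have h2 := h.add_two_le hH
  have := h.2.2 (i + 1) (by omega) (by omega)
  exact sgn_eq_of_lt (by have := hH i; omega)

theorem FirstReturn.eq_pos (hH : ∀ i, H (i + 1) = H i + (x i).sgn) {i j : ℤ}
    (h : FirstReturn H i j) : x (j - 1) = .pos (x (j - 1)).label := by
  have h2 := h.add_two_le hH
  have h3 := h.2.2 (j - 1) (by omega) (by omega)
  have h4 := h.2.1
  have h5 := hH (j - 1)
  rw [sub_add_cancel] at h5
  exact sgn_eq_of_gt (by omega)

/-- The word strictly between matching brackets starts and ends at the same height without going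
below it, so its product is 0 or 1; in the second case the two brackets become adjacent. -/
theorem label_eq_of_mem_dyckShift (hH : ∀ i, H (i + 1) = H i + (x i).sgn)
    (hx : x ∈ dyckShift Γ) {i j : ℤ} (h : FirstReturn H i j) :
    (x i).label = (x (j - 1)).label := by
  by_contra hne
  have h2 := h.add_two_le hH
  obtain ⟨m, hm⟩ : ∃ m : ℕ, j = i + 1 + m + 1 := ⟨(j - i - 2).toNat, by omega⟩
  have hjm : i + 1 + m = j - 1 := by omega
  have hi := h.eq_neg hH
  have hj := h.eq_pos hH
  have hi1 : H (i + 1) = H i + 1 := by rw [hH i, hi]; rfl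
  have hj1 : H j = H (i + 1 + m) - 1 := by rw [hm, hH, hjm, hj]; rfl
  have hmid := prod_subwordAt_of_le hH (i + 1) m fun k hk => by
    have := h.2.2 (i + 1 + k) (by omega) (by omega)
    omega
  refine hx i (m + 1 + 1) ?_
  rw [subwordAt_succ, subwordAt_succ', List.map_cons, List.map_append, List.prod_cons,
    List.prod_append, hjm, hi, hj]
  rcases hmid with h0 | ⟨v, hv, hp⟩
  · rw [h0, DyckMonoid.zero_mul', DyckMonoid.mul_zero']
  · have : v = [] := by
      rw [← List.length_eq_zero_iff]
      have := h.2.1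
      omega
    rw [hp, this]
    simpa using DyckMonoid.gen_neg_mul_gen_pos_of_ne hne

/-- The stack `σ` at position `i` meets all later closing letters that it has to match. -/
def StackFits (x : ℤ → DyckLetter Γ) (H : ℤ → ℤ) (i : ℤ) (σ : ℕ → Γ) : Prop :=
  ∀ (k : ℕ) (j : ℤ), i < j → H j = H i - 1 - k → (∀ l, i ≤ l → l < j → H j < H l) →
    (x (j - 1)).label = σ k

/-- For each depth k at most one j imposes a condition: of two such times, the earlier would have to
lie strictly above the later, at equal height. -/
theorem exists_stackFits [Nonempty Γ] (i : ℤ) : ∃ σ, StackFits x H i σ := by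
  have : ∀ k : ℕ, ∃ γ : Γ, ∀ j : ℤ, i < j → H j = H i - 1 - k →
      (∀ l, i ≤ l → l < j → H j < H l) → (x (j - 1)).label = γ := by
    intro k
    by_cases h : ∃ j : ℤ, i < j ∧ H j = H i - 1 - k ∧ ∀ l, i ≤ l → l < j → H j < H l
    · obtain ⟨j, h1, h2, h3⟩ := h
      refine ⟨(x (j - 1)).label, fun j' h1' h2' h3' => ?_⟩
      rcases lt_trichotomy j j' with hlt | rfl | hlt
      · have := h3' j h1.le hlt
        omega
      · rfl
      · have := h3 j' h1'.le hlt
        omega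
    · push Not at h
      obtain ⟨γ⟩ := ‹Nonempty Γ›
      refine ⟨γ, fun j h1 h2 h3 => ?_⟩
      obtain ⟨l, hl1, hl2, hl3⟩ := h j h1 h2
      exact absurd (h3 l hl1 hl2) (by omega)
  choose σ hσ using this
  exact ⟨σ, hσ⟩

/-- The invariant is that the stack fits at the current position: a push keeps it because matching
labels agree, and each pop finds the label it needs. Hence a fitting stack witnesses that the
product is nonzero. -/
theorem action_prod_subwordAt (hH : ∀ i, H (i + 1) = H i + (x i).sgn)
    (hx : ∀ i j, FirstReturn H i j → (x i).label = (x (j - 1)).label) (m : ℕ) (i : ℤ)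
    (σ : ℕ → Γ) (hσ : StackFits x H i σ) :
    DyckMonoid.action Γ ((subwordAt x i m).map DyckMonoid.gen).prod (fun _ => 1) σ = 1 := by
  induction m generalizing i σ with
  | zero => simp [subwordAt]
  | succ m ih =>
    rw [subwordAt_succ, List.map_cons, List.prod_cons, map_mul, Module.End.mul_apply,
      DyckMonoid.action_gen]
    have hHi := hH i
    rcases hxi : x i with γ | γ
    · rw [DyckMonoid.letterAction_neg]
      refine ih _ _ ?_
      simp only [hxi, DyckLetter.sgn] at hHi
      rintro (_ | k) j h1 h2 h3
      · have := hx i j ⟨by omega, by push_cast at h2; omega, fun l hl1 hl2 => by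
          have := h3 l (by omega) hl2
          push_cast at h2
          omega⟩
        rw [← this, hxi]
        rfl
      · refine hσ k j (by omega) (by push_cast at h2; omega) fun l hl1 hl2 => ?_
        rcases hl1.eq_or_lt with rfl | hl1
        · push_cast at h2
          omega
        · exact h3 l (by omega) hl2
    · simp only [hxi, DyckLetter.sgn] at hHi
      -- The closing letter at i is itself the first descent below H i, so it is the one that the
      -- top entry must fit.
      have h0 : σ 0 = γ := by
        rw [← hσ 0 (i + 1) (by omega) (by push_cast; omega) fun l hl1 hl2 => by
          obtain rfl : l = i := by omega
          omega, add_sub_cancel_right, hxi]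
        rfl
      rw [DyckMonoid.letterAction_pos_of_eq _ h0]
      refine ih _ _ fun k j h1 h2 h3 => ?_
      refine hσ (k + 1) j (by omega) (by push_cast; omega) fun l hl1 hl2 => ?_
      rcases hl1.eq_or_lt with rfl | hl1
      · omega
      · exact h3 l (by omega) hl2

/-- A sequence is in the Dyck shift if and only if matching brackets have the same label. -/
theorem mem_dyckShift_iff [Nonempty Γ] (hH : ∀ i, H (i + 1) = H i + (x i).sgn) :
    x ∈ dyckShift Γ ↔ ∀ i j, FirstReturn H i j → (x i).label = (x (j - 1)).label := by
  refine ⟨fun hx i j h => label_eq_of_mem_dyckShift hH hx h, fun hx i m h0 => ?_⟩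
  obtain ⟨σ, hσ⟩ := exists_stackFits (x := x) (H := H) i
  have h1 := action_prod_subwordAt hH hx m i σ hσ
  rw [h0, DyckMonoid.action_zero] at h1
  simp at h1

end dyck

/-! ### Height paths and first returns -/

/-- The path with increments `e` that starts in `0` at time `0`. -/
def pathHeight (e : ℤ → ℤ) : ℤ → ℤ
  | Int.ofNat m => ∑ k ∈ Finset.range m, e k
  | Int.negSucc m => -∑ k ∈ Finset.range (m + 1), e (-(k + 1 : ℕ))

theorem pathHeight_natCast (e : ℤ → ℤ) (m : ℕ) :
    pathHeight e m = ∑ k ∈ Finset.range m, e k := rfl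

theorem pathHeight_succ (e : ℤ → ℤ) (i : ℤ) : pathHeight e (i + 1) = pathHeight e i + e i := by
  match i with
  | Int.ofNat m =>
    have : Int.ofNat m + 1 = ((m + 1 : ℕ) : ℤ) := rfl
    rw [this, pathHeight_natCast, Finset.sum_range_succ]
    rfl
  | Int.negSucc 0 =>
    have : Int.negSucc 0 + 1 = ((0 : ℕ) : ℤ) := rfl
    rw [this, pathHeight_natCast]
    simp [pathHeight]
  | Int.negSucc (m + 1) =>
    have : Int.negSucc (m + 1) + 1 = Int.negSucc m := by
      simp only [Int.negSucc_eq]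
      push_cast
      ring
    rw [this]
    simp only [pathHeight]
    rw [Finset.sum_range_succ _ (m + 1)]
    have h2 : Int.negSucc (m + 1) = -((m + 1 + 1 : ℕ) : ℤ) := rfl
    rw [h2]
    ring

theorem pathHeight_add_mul {n : ℕ} [NeZero n] (e : ZMod n → ℤ) (i q : ℤ) :
    pathHeight (fun k : ℤ => e k) (i + n * q) =
      pathHeight (fun k : ℤ => e k) i + (∑ r, e r) * q := by
  set H := pathHeight fun k : ℤ => e k
  have hs : ∀ i, H (i + 1) = H i + e i := pathHeight_succ _
  have h0 : H n = ∑ r, e r := by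
    refine (pathHeight_natCast _ _).trans ?_
    refine Finset.sum_nbij' (fun k : ℕ => (k : ZMod n)) ZMod.val ?_ ?_ ?_ ?_ ?_
    · simp
    · simp [ZMod.val_lt]
    · exact fun a ha => ZMod.val_cast_of_lt (Finset.mem_range.1 ha)
    · simp
    · simp
  have h1 : ∀ i : ℤ, H (i + n) = H i + ∑ r, e r := by
    intro i
    induction i using Int.induction_on with
    | zero =>
      rw [zero_add, h0]
      simp [H, pathHeight]
    | succ i ih =>
      rw [add_right_comm, hs, ih, hs]
      simp
      ring
    | pred i ih =>
      have h2 := hs (-i - 1)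
      have h3 := hs (-i - 1 + n)
      rw [show (-i - 1 + n + 1 : ℤ) = -i + n by ring] at h3
      rw [sub_add_cancel] at h2
      push_cast at h2 h3
      rw [ZMod.natCast_self, add_zero] at h3
      linarith
  induction q using Int.induction_on with
  | zero => simp
  | succ q ih =>
    rw [show i + n * ((q : ℤ) + 1) = i + n * q + n by ring, h1, ih]
    ring
  | pred q ih =>
    have h2 := h1 (i + n * (-(q : ℤ) - 1))
    rw [show i + n * (-(q : ℤ) - 1) + n = i + n * (-(q : ℤ)) by ring, ih] at h2
    linarith

section path
variable {H : ℤ → ℤ}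

theorem FirstReturn.right_unique {i j j' : ℤ} (h : FirstReturn H i j) (h' : FirstReturn H i j') :
    j = j' := by
  rcases lt_trichotomy j j' with hlt | rfl | hlt
  · have := h'.2.2 j h.1 hlt
    have := h.2.1
    omega
  · rfl
  · have := h.2.2 j' h'.1 hlt
    have := h'.2.1
    omega

theorem FirstReturn.left_unique {i i' j : ℤ} (h : FirstReturn H i j) (h' : FirstReturn H i' j) :
    i = i' := by
  have h1 := h.2.1
  have h2 := h'.2.1
  rcases lt_trichotomy i i' with hlt | rfl | hlt
  · have := h.2.2 i' hlt h'.1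
    omega
  · rfl
  · have := h'.2.2 i hlt h.1
    omega

theorem FirstReturn.last_step (hs : ∀ i, H (i + 1) = H i + 1 ∨ H (i + 1) = H i - 1) {i j : ℤ}
    (h : FirstReturn H i j) : H (j - 1) = H j + 1 := by
  obtain ⟨h1, h2, h3⟩ := h
  have h4 := hs (j - 1)
  rw [sub_add_cancel] at h4
  rcases (show i ≤ j - 1 by omega).eq_or_lt with h5 | h5
  · rw [← h5] at h4
    omega
  · have := h3 (j - 1) h5 (by omega)
    omega

/-- Unit steps cannot jump over a level, so the least later time at height at most H i is a return
to exactly H i. -/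
theorem exists_firstReturn_right (hs : ∀ i, H (i + 1) = H i + 1 ∨ H (i + 1) = H i - 1) {i j : ℤ}
    (hi : H (i + 1) = H i + 1) (hij : i < j) (hj : H j ≤ H i) : ∃ j, FirstReturn H i j := by
  obtain ⟨l, ⟨hl1, hl2⟩, hl3⟩ := Int.exists_least_of_bdd (P := fun l => i < l ∧ H l ≤ H i)
    ⟨i, fun z hz => hz.1.le⟩ ⟨j, hij, hj⟩
  have hmin : ∀ k, i < k → k < l → H i < H k := fun k h1 h2 => by
    by_contra hc
    have := hl3 k ⟨h1, by omega⟩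
    omega
  refine ⟨l, hl1, ?_, hmin⟩
  rcases (show i + 1 ≤ l by omega).eq_or_lt with rfl | h5
  · omega
  · have h6 := hmin (l - 1) (by omega) (by omega)
    have h7 := hs (l - 1)
    rw [sub_add_cancel] at h7
    omega

theorem exists_firstReturn_left (hs : ∀ i, H (i + 1) = H i + 1 ∨ H (i + 1) = H i - 1) {i p : ℤ}
    (hp : H (p + 1) = H p - 1) (hip : i ≤ p) (hi : H i ≤ H (p + 1)) :
    ∃ i, FirstReturn H i (p + 1) := by
  obtain ⟨l, ⟨hl1, hl2⟩, hl3⟩ := Int.exists_greatest_of_bdd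
    (P := fun l => l ≤ p ∧ H l ≤ H (p + 1)) ⟨p, fun z hz => hz.1⟩ ⟨i, hip, hi⟩
  have hmax : ∀ k, l < k → k < p + 1 → H (p + 1) < H k := fun k h1 h2 => by
    by_contra hc
    have := hl3 k ⟨by omega, by omega⟩
    omega
  have hl : H (p + 1) = H l := by
    rcases hl1.eq_or_lt with rfl | h5
    · omega
    · have h6 := hmax (l + 1) (by omega) (by omega)
      have h7 := hs l
      omega
  exact ⟨l, by omega, hl, fun k h1 h2 => by rw [← hl]; exact hmax k h1 h2⟩

end path

/-! ### Matching in periodic skeletons -/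

section periodic
variable {Γ : Type*} {n : ℕ}

/-- The sign of a symbol, where `Sum.inl γ` stands for `γ(+)` and `Sum.inr ()` for any of the
`γ(-)`. -/
def skeletonSgn : Γ ⊕ Unit → ℤ := Sum.elim (fun _ => -1) (fun _ => 1)

/-- The height path of a periodic sequence. -/
def skeletonHeight (c : ZMod n → Γ ⊕ Unit) : ℤ → ℤ :=
  pathHeight fun k : ℤ => skeletonSgn (c k)

theorem skeletonHeight_succ (c : ZMod n → Γ ⊕ Unit) (i : ℤ) :
    skeletonHeight c (i + 1) = skeletonHeight c i + skeletonSgn (c i) :=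
  pathHeight_succ _ _

theorem skeletonHeight_step (c : ZMod n → Γ ⊕ Unit) (i : ℤ) :
    skeletonHeight c (i + 1) = skeletonHeight c i + 1 ∨
      skeletonHeight c (i + 1) = skeletonHeight c i - 1 := by
  rw [skeletonHeight_succ]
  rcases c i with γ | γ
  · right; rfl
  · left; rfl

theorem eq_inr_of_firstReturn {c : ZMod n → Γ ⊕ Unit} {i j : ℤ}
    (h : FirstReturn (skeletonHeight c) i j) : c ((j - 1 : ℤ) : ZMod n) ≠ Sum.inr () := by
  intro hc
  have h1 := h.last_step (skeletonHeight_step c)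
  have h2 := skeletonHeight_succ c (j - 1)
  rw [sub_add_cancel, hc] at h2
  simp [skeletonSgn] at h2
  omega

variable [NeZero n]

theorem skeletonHeight_add_mul (c : ZMod n → Γ ⊕ Unit) (i q : ℤ) :
    skeletonHeight c (i + n * q) = skeletonHeight c i + (∑ r, skeletonSgn (c r)) * q :=
  pathHeight_add_mul (fun r => skeletonSgn (c r)) i q

theorem firstReturn_skeleton_add {c : ZMod n → Γ ⊕ Unit} {i j : ℤ} (q : ℤ)
    (h : FirstReturn (skeletonHeight c) i j) :
    FirstReturn (skeletonHeight c) (i + n * q) (j + n * q) := by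
  obtain ⟨h1, h2, h3⟩ := h
  refine ⟨by omega, by rw [skeletonHeight_add_mul, skeletonHeight_add_mul, h2], fun k hk1 hk2 => ?_⟩
  have h4 := h3 (k - n * q) (by omega) (by omega)
  have h5 := skeletonHeight_add_mul c (k - n * q) q
  rw [sub_add_cancel] at h5
  rw [h5, skeletonHeight_add_mul]
  omega

theorem intCast_val_add (i : ℤ) : (((i : ZMod n).val : ℕ) : ℤ) + n * (i / n) = i := by
  rw [ZMod.val_intCast]
  exact Int.emod_add_mul_ediv i n

theorem firstReturn_skeleton_val {c : ZMod n → Γ ⊕ Unit} {i j : ℤ}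
    (h : FirstReturn (skeletonHeight c) i j) :
    FirstReturn (skeletonHeight c) ((i : ZMod n).val : ℕ) (j - n * (i / n)) := by
  have h1 := firstReturn_skeleton_add (-(i / n)) h
  have h2 := intCast_val_add (n := n) i
  convert h1 using 1
  · linarith
  · ring

open Classical in
/-- The positions of the opening brackets that are never closed. -/
def unmatched (c : ZMod n → Γ ⊕ Unit) : Finset (ZMod n) :=
  {i | c i = Sum.inr () ∧ ¬∃ j, FirstReturn (skeletonHeight c) (i.val : ℕ) j}

/-- With negative drift every opening bracket is closed within one period. With nonnegative drift
every closing bracket has a partner, so matching is a bijection modulo n from matched opening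
brackets to all closing ones, and the excess of opening brackets is the drift. -/
theorem card_unmatched (c : ZMod n → Γ ⊕ Unit) :
    ((unmatched c).card : ℤ) = max (∑ r, skeletonSgn (c r)) 0 := by
  classical
  set h := ∑ r, skeletonSgn (c r)
  set H := skeletonHeight c
  have hs : ∀ i, H (i + 1) = H i + 1 ∨ H (i + 1) = H i - 1 := skeletonHeight_step c
  have hsucc : ∀ i : ℤ, H (i + 1) = H i + skeletonSgn (c i) := skeletonHeight_succ c
  have hadd : ∀ i q : ℤ, H (i + n * q) = H i + h * q := skeletonHeight_add_mul c
  have hn : 0 < (n : ℤ) := by exact_mod_cast Nat.pos_of_neZero n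
  have hval : ∀ r : ZMod n, (((r.val : ℕ) : ℤ) : ZMod n) = r := fun r => by simp
  rcases lt_or_ge h 0 with hneg | hpos
  · have : unmatched c = ∅ := by
      rw [unmatched, Finset.filter_eq_empty_iff]
      rintro r - ⟨hr, hno⟩
      refine hno (exists_firstReturn_right hs (j := r.val + n * 1) ?_ (by omega) ?_)
      · rw [hsucc, hval, hr]
        rfl
      · rw [hadd]
        omega
    rw [this, max_eq_right hneg.le]
    rfl
  · rw [max_eq_left hpos]
    have hh : h = ((Finset.univ.filter fun r => c r = Sum.inr ()).card : ℤ) -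
        (Finset.univ.filter fun r => c r ≠ Sum.inr ()).card := by
      have : ∀ r, skeletonSgn (c r) = if c r = Sum.inr () then 1 else -1 := fun r => by
        rcases c r with γ | γ <;> simp [skeletonSgn]
      simp only [h, this]
      rw [Finset.sum_ite]
      simp
      ring
    have hsplit : (Finset.univ.filter fun r => c r = Sum.inr ()).card =
        (Finset.univ.filter fun r => c r = Sum.inr () ∧ ∃ j, FirstReturn H (r.val : ℕ) j).card +
          (unmatched c).card := by
      rw [← Finset.card_filter_add_card_filter_not
        (p := fun r : ZMod n => ∃ j, FirstReturn H (r.val : ℕ) j), Finset.filter_filter,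
        Finset.filter_filter]
      rfl
    have hbij : (Finset.univ.filter fun r => c r = Sum.inr () ∧
        ∃ j, FirstReturn H (r.val : ℕ) j).card =
        (Finset.univ.filter fun r => c r ≠ Sum.inr ()).card := by
      have hJ : ∀ r : ZMod n, ∃ j, (∃ j, FirstReturn H (r.val : ℕ) j) →
          FirstReturn H (r.val : ℕ) j := fun r => by
        by_cases hr : ∃ j, FirstReturn H (r.val : ℕ) j
        · exact hr.imp fun _ hj _ => hj
        · exact ⟨0, fun h => absurd h hr⟩
      choose J hJ using hJ
      refine Finset.card_bij (fun r _ => ((J r - 1 : ℤ) : ZMod n)) ?_ ?_ ?_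
      · intro r hr
        simp only [Finset.mem_filter, Finset.mem_univ, true_and] at hr ⊢
        exact eq_inr_of_firstReturn (hJ r hr.2)
      · intro r hr r' hr' heq
        simp only [Finset.mem_filter, Finset.mem_univ, true_and] at hr hr'
        rw [ZMod.intCast_eq_intCast_iff_dvd_sub] at heq
        obtain ⟨q, hq⟩ := heq
        -- Translation by whole periods makes the two right ends equal; then the left ends agree as
        -- well.
        have h1 := firstReturn_skeleton_add q (hJ r hr.2)
        rw [show J r + n * q = J r' by omega] at h1
        have h2 := congrArg (Int.cast : ℤ → ZMod n) (h1.left_unique (hJ r' hr'.2))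
        simpa using h2
      · intro p hp
        simp only [Finset.mem_filter, Finset.mem_univ, true_and] at hp
        have hp1 : H ((p.val : ℕ) + 1) = H (p.val : ℕ) - 1 := by
          have h1 := hsucc (p.val : ℕ)
          rw [hval] at h1
          rcases hc : c p with γ | γ
          · rw [hc] at h1
            exact h1
          · exact absurd hc hp
        -- One period before p + 1 the path is no higher than at p + 1, because the drift is
        -- nonnegative.
        obtain ⟨i, hi⟩ := exists_firstReturn_left hs (i := (p.val : ℕ) + 1 + n * (-1)) hp1
          (by omega) (by
            rw [hadd]
            omega)
        have h1 := firstReturn_skeleton_val hi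
        have hi1 : H (i + 1) = H i + 1 := by
          rcases hs i with h2 | h2
          · exact h2
          · have h3 := hi.2.2 (i + 1) (by omega) ?_
            · omega
            · have h4 := hi.1
              have h5 := hi.2.1
              by_contra hc
              rw [show ((p.val : ℕ) + 1 : ℤ) = i + 1 by omega] at h5
              omega
        refine ⟨i, ?_, ?_⟩
        · simp only [Finset.mem_filter, Finset.mem_univ, true_and]
          refine ⟨?_, _, h1⟩
          have h2 := hsucc i
          rcases hc : c i with γ | γ
          · rw [hc] at h2
            change _ = H i + -1 at h2
            omega
          · rfl
        · rw [(hJ i ⟨_, h1⟩).right_unique h1]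
          simp
    omega

end periodic

/-! ### Counting periodic points by skeletons -/

namespace DyckLetter
variable {Γ : Type*}

/-- A letter, forgetting the labels of opening brackets. -/
def skeleton : DyckLetter Γ → Γ ⊕ Unit
  | neg _ => Sum.inr ()
  | pos γ => Sum.inl γ

theorem skeletonSgn_skeleton (a : DyckLetter Γ) : skeletonSgn a.skeleton = a.sgn := by
  cases a <;> rfl

theorem skeleton_eq_inl {a : DyckLetter Γ} {γ : Γ} : a.skeleton = Sum.inl γ ↔ a = pos γ := by
  cases a <;> simp [skeleton]

theorem skeleton_eq_inr {a : DyckLetter Γ} : a.skeleton = Sum.inr () ↔ a = neg a.label := by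
  cases a <;> simp [skeleton, label]

instance [Finite Γ] : Finite (DyckLetter Γ) :=
  Finite.of_injective (fun a : DyckLetter Γ => (a.skeleton, a.label)) <| by
    rintro (a | a) (b | b) h <;> simp_all [skeleton, label]

end DyckLetter

/-- The periodic sequence with a given cyclic period. -/
def unroll {A : Type*} {n : ℕ} (y : ZMod n → A) : ℤ → A := fun k => y k

theorem unroll_injective {A : Type*} {n : ℕ} : Function.Injective (unroll (A := A) (n := n)) :=
  fun y y' h => funext fun r => by
    obtain ⟨k, rfl⟩ := ZMod.intCast_surjective r
    exact congrFun h k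

theorem ptsOfPeriod_shift {A : Type*} (n : ℕ) [NeZero n] :
    Function.ptsOfPeriod (SymbolicDynamics.FullShift.shift (A := A) (1 : ℤ)) n =
      Set.range (unroll (A := A) (n := n)) := by
  have hit : ∀ (m : ℕ) (x : ℤ → A) (k : ℤ),
      (SymbolicDynamics.FullShift.shift (1 : ℤ))^[m] x k = x (k + m) := by
    intro m
    induction m with
    | zero => simp
    | succ m ih =>
      intro x k
      rw [Function.iterate_succ_apply, ih]
      change x (1 + (k + m)) = _
      push_cast
      congr 1
      ring
  ext x
  rw [Function.mem_ptsOfPeriod, Function.IsPeriodicPt, Function.IsFixedPt]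
  constructor
  · intro h
    have hp : Function.Periodic x (n : ℤ) := fun k => by rw [← hit n x k, h]
    refine ⟨fun r => x (r.val : ℕ), funext fun k => ?_⟩
    rw [unroll, ZMod.val_intCast]
    have h1 := hp.zsmul (k / n) (k % n)
    rwa [smul_eq_mul, mul_comm, Int.emod_add_mul_ediv, eq_comm] at h1
  · rintro ⟨y, rfl⟩
    ext k
    rw [hit]
    simp [unroll]

section count
variable {Γ : Type*} {n : ℕ}

/-- The condition that no removed word appears, on the skeleton of a cyclic word. -/
def Allowed (Ψ : Γ → Finset Γ) (c : ZMod n → Γ ⊕ Unit) : Prop :=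
  ∀ i α β, c i = Sum.inl β → c (i + 1) = Sum.inl α → β ∈ Ψ α

/-- The forbidden words consist of closing letters, so labels of opening letters enter only through
matching. -/
theorem unroll_mem_dyckShiftRemoved_iff [Nonempty Γ] {Ψ : Γ → Finset Γ}
    {y : ZMod n → DyckLetter Γ} {c : ZMod n → Γ ⊕ Unit} (hc : ∀ r, (y r).skeleton = c r) :
    unroll y ∈ dyckShiftRemoved Ψ ↔
      (∀ i j, FirstReturn (skeletonHeight c) i j →
        (y (i : ZMod n)).label = (y ((j - 1 : ℤ) : ZMod n)).label) ∧ Allowed Ψ c := by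
  have hH : ∀ i, skeletonHeight c (i + 1) = skeletonHeight c i + (unroll y i).sgn := fun i => by
    rw [skeletonHeight_succ, ← hc, DyckLetter.skeletonSgn_skeleton]
    rfl
  refine and_congr (mem_dyckShift_iff hH) ?_
  simp only [subwordAt_eq_map, Allowed, ← hc, DyckLetter.skeleton_eq_inl]
  constructor
  · intro h r α β h1 h2
    obtain ⟨k, rfl⟩ := ZMod.intCast_surjective r
    by_contra hn
    refine h α β hn k ?_
    simp [List.range_succ, unroll, h1, h2]
  · intro h α β hn k heq
    simp [List.range_succ, unroll] at heq
    exact hn (h k α β heq.1 heq.2)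

variable [NeZero n]

open Classical in
theorem card_fiber_skeleton [Fintype Γ] [Nonempty Γ] [Fintype (DyckLetter Γ)] (Ψ : Γ → Finset Γ)
    (c : ZMod n → Γ ⊕ Unit) :
    (Finset.univ.filter fun y : ZMod n → DyckLetter Γ =>
      unroll y ∈ dyckShiftRemoved Ψ ∧ (fun r => (y r).skeleton) = c).card =
      if Allowed Ψ c then Fintype.card Γ ^ (unmatched c).card else 0 := by
  split_ifs with hA
  · have hJ : ∀ r : ZMod n, ∃ j, (∃ j, FirstReturn (skeletonHeight c) (r.val : ℕ) j) →
        FirstReturn (skeletonHeight c) (r.val : ℕ) j := fun r => by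
      by_cases hr : ∃ j, FirstReturn (skeletonHeight c) (r.val : ℕ) j
      · exact hr.imp fun _ hj _ => hj
      · exact ⟨0, fun h => absurd h hr⟩
    choose J hJ using hJ
    -- The arbitrary value is never relevant: L determines a letter only at a matched opening
    -- bracket, where `J r - 1` carries a closing letter.
    let L : Γ ⊕ Unit → Γ := Sum.elim id fun _ => Classical.arbitrary Γ
    have hL : ∀ a : DyckLetter Γ, a.skeleton ≠ Sum.inr () → a.label = L a.skeleton := by
      rintro (a | a) h
      · exact absurd rfl h
      · rfl
    let S : ZMod n → Finset (DyckLetter Γ) := fun r =>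
      if r ∈ unmatched c then Finset.univ.image DyckLetter.neg
      else {Sum.elim DyckLetter.pos (fun _ => DyckLetter.neg (L (c ((J r - 1 : ℤ) : ZMod n)))) (c r)}
    have hS : (Finset.univ.filter fun y : ZMod n → DyckLetter Γ =>
        unroll y ∈ dyckShiftRemoved Ψ ∧ (fun r => (y r).skeleton) = c) = Fintype.piFinset S := by
      ext y
      simp only [Finset.mem_filter, Finset.mem_univ, true_and, Fintype.mem_piFinset]
      have hmem : ∀ r, r ∈ unmatched c ↔ c r = Sum.inr () ∧
          ¬∃ j, FirstReturn (skeletonHeight c) (r.val : ℕ) j := fun r => by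
        simp [unmatched]
      constructor
      · rintro ⟨hy, hc⟩ r
        replace hc : ∀ r, (y r).skeleton = c r := congrFun hc
        rw [unroll_mem_dyckShiftRemoved_iff hc] at hy
        simp only [S]
        split_ifs with hr
        · rw [hmem, ← hc, DyckLetter.skeleton_eq_inr] at hr
          rw [hr.1]
          simp
        · rw [Finset.mem_singleton]
          rcases hcr : c r with γ | γ
          · rw [← hc, DyckLetter.skeleton_eq_inl] at hcr
            exact hcr
          · rw [hmem, not_and_not_right] at hr
            have h1 := hJ r (hr hcr)
            have h2 := hy.1 _ _ h1
            have h3 := eq_inr_of_firstReturn h1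
            rw [← hc] at h3
            rw [hL _ h3, hc] at h2
            rw [← hc, DyckLetter.skeleton_eq_inr] at hcr
            rw [hcr]
            simpa using h2
      · intro hy
        have hc : ∀ r, (y r).skeleton = c r := by
          intro r
          have h1 := hy r
          simp only [S] at h1
          split_ifs at h1 with hr
          · rw [hmem] at hr
            obtain ⟨γ, -, hγ⟩ := Finset.mem_image.1 h1
            rw [hr.1, ← hγ]
            rfl
          · rw [Finset.mem_singleton] at h1
            rw [h1]
            rcases c r with γ | γ <;> rfl
        refine ⟨(unroll_mem_dyckShiftRemoved_iff hc).2 ⟨fun i j hij => ?_, hA⟩, funext hc⟩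
        have h1 := firstReturn_skeleton_val hij
        have h2 := hJ _ ⟨_, h1⟩
        have h3 : (((J i : ℤ) - 1 : ℤ) : ZMod n) = ((j - 1 : ℤ) : ZMod n) := by
          rw [h2.right_unique h1]
          simp
        have h4 := eq_inr_of_firstReturn hij
        rw [← hc] at h4
        rw [hL _ h4, hc, ← h3]
        have h5 := hy i
        have h6 : (i : ZMod n) ∉ unmatched c := by
          rw [hmem, not_and_not_right]
          exact fun _ => ⟨_, h1⟩
        have hs := skeletonHeight_succ c i
        have hci : c i = Sum.inr () := by
          rcases hci : c i with γ | γ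
          · rw [hci] at hs
            change _ = _ + -1 at hs
            have h7 := hij.2.1
            have h8 := hij.1
            rcases (show i + 1 ≤ j by omega).eq_or_lt with rfl | h9
            · omega
            · have := hij.2.2 (i + 1) (by omega) h9
              omega
          · rfl
        simp only [S, if_neg h6, Finset.mem_singleton] at h5
        rw [h5, hci]
        rfl
    rw [hS, Fintype.card_piFinset]
    have hcard : ∀ r, (S r).card = if r ∈ unmatched c then Fintype.card Γ else 1 := by
      intro r
      simp only [S]
      split_ifs with hr
      · rw [Finset.card_image_of_injective _ (fun a b h => by injection h), Finset.card_univ]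
      · simp
    simp only [hcard]
    rw [Finset.prod_ite]
    simp
  · rw [Finset.card_eq_zero, Finset.filter_eq_empty_iff]
    rintro y - ⟨hy, rfl⟩
    exact hA ((unroll_mem_dyckShiftRemoved_iff fun _ => rfl).1 hy).2

open Classical in
theorem ncard_periodic [Fintype Γ] [Nonempty Γ] (Ψ : Γ → Finset Γ) :
    (dyckShiftRemoved Ψ ∩ Function.ptsOfPeriod
      (SymbolicDynamics.FullShift.shift (1 : ℤ)) n).ncard =
    ∑ c : ZMod n → Γ ⊕ Unit,
      if Allowed Ψ c then Fintype.card Γ ^ (∑ r, skeletonSgn (c r)).toNat else 0 := by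
  have := Fintype.ofFinite (DyckLetter Γ)
  rw [ptsOfPeriod_shift, ← Set.image_preimage_eq_inter_range,
    Set.ncard_image_of_injective _ unroll_injective,
    show unroll ⁻¹' dyckShiftRemoved Ψ =
      ((Finset.univ.filter fun y : ZMod n → DyckLetter Γ => unroll y ∈ dyckShiftRemoved Ψ :
        Finset (ZMod n → DyckLetter Γ)) : Set (ZMod n → DyckLetter Γ)) by ext; simp,
    Set.ncard_coe_finset,
    Finset.card_eq_sum_card_fiberwise (f := fun y r => (y r).skeleton) (t := Finset.univ)
      (fun _ _ => Finset.mem_coe.2 (Finset.mem_univ _))]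
  refine Finset.sum_congr rfl fun c _ => ?_
  rw [Finset.filter_filter, card_fiber_skeleton]
  have h : (unmatched c).card = (∑ r, skeletonSgn (c r)).toNat := by
    have := card_unmatched c
    omega
  rw [h]

end count

/-! ### The determinant of the transfer matrix -/

namespace Matrix

section transfer
variable {R S ι : Type*} [CommRing R] [CommRing S] [Fintype ι] [DecidableEq ι]

theorem map_det_oneSubX (f : R →+* S) (M : Matrix ι ι R) :
    PowerSeries.map f (oneSubX M).det = (oneSubX (M.map f)).det := by
  rw [RingHom.map_det]
  congr 1
  ext i j : 2
  rcases eq_or_ne i j with rfl | hij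
  · simp [oneSubX]
  · simp [oneSubX, hij]

/-- The matrix `s • A`, extended by a row of entries `t` and a column of entries `s`. -/
def bordered (A : Matrix ι ι R) (s t : R) : Matrix (ι ⊕ Unit) (ι ⊕ Unit) R :=
  fromBlocks (s • A) (of fun _ _ => s) (of fun _ _ => t) (of fun _ _ => t)

theorem det_oneSubX_bordered (A : Matrix ι ι R) (s t : R) (hst : s * t = 1) (K : R)
    (hK : ∀ j, ∑ i, A i j = K) :
    (1 - X * C (K * s)) * (oneSubX (bordered A s t)).det =
      (oneSubX (s • A)).det *
        ((1 - X * C t) * (1 - X * C (K * s)) - C (Fintype.card ι : R) * X ^ 2) := by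
  have h1 : oneSubX (bordered A s t) = fromBlocks (oneSubX (s • A)) (of fun _ _ => -(X * C s))
      (of fun _ _ => -(X * C t)) (of fun _ _ => 1 - X * C t) := by
    ext (i | i) (j | j) : 2
    · simp [oneSubX, bordered, one_apply]
    · simp [oneSubX, bordered]
    · simp [oneSubX, bordered]
    · simp [oneSubX, bordered]
  -- A row operation: scale the last row by 1 - KsX and add Xt times the sum of the other rows. As
  -- the columns of A sum to K, the lower left block vanishes.
  let L : Matrix (ι ⊕ Unit) (ι ⊕ Unit) R⟦X⟧ := fromBlocks 1 0 (of fun _ _ => X * C t)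
    (of fun _ _ => 1 - X * C (K * s))
  have hLdet : L.det = 1 - X * C (K * s) := by
    simp [L, det_fromBlocks_zero₁₂]
  have hst' : (C s * C t : R⟦X⟧) = 1 := by rw [← map_mul, hst, map_one]
  have hL : L * oneSubX (bordered A s t) = fromBlocks (oneSubX (s • A)) (of fun _ _ => -(X * C s)) 0
      (of fun _ _ => (1 - X * C t) * (1 - X * C (K * s)) - C (Fintype.card ι : R) * X ^ 2) := by
    rw [h1, fromBlocks_multiply]
    congr 1
    · simp
    · simp
    · refine Matrix.ext fun i j => ?_
      have h2 : ∑ k, oneSubX (s • A) k j = 1 - X * C (K * s) := by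
        simp only [oneSubX, sub_apply, Finset.sum_sub_distrib]
        congr 1
        · simp [one_apply]
        · simp [← Finset.mul_sum, ← map_sum, hK, mul_comm]
      simp only [add_apply, mul_apply, of_apply, zero_apply, ← Finset.mul_sum, h2]
      simp
      ring
    · refine Matrix.ext fun i j => ?_
      simp only [add_apply, mul_apply, of_apply, Finset.sum_const, Finset.card_univ, nsmul_eq_mul]
      simp
      linear_combination (-(Fintype.card ι : R⟦X⟧) * X ^ 2) * hst'
  have h3 := congrArg det hL
  rw [det_mul, hLdet, det_fromBlocks_zero₂₁] at h3
  rw [h3, det_unique (n := Unit)]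
  rfl

end transfer

end Matrix

/-! ### The height functional on Laurent polynomials -/

/-- The linear functional with `T h ↦ N ^ max h 0`. -/
def heightWeight (N : ℚ) : LaurentPolynomial ℚ →ₗ[ℚ] ℚ :=
  (AddMonoidAlgebra.basis ℤ ℚ).constr ℚ fun h : ℤ => N ^ h.toNat

theorem heightWeight_T (N : ℚ) (h : ℤ) : heightWeight N (LaurentPolynomial.T h) = N ^ h.toNat := by
  have := (AddMonoidAlgebra.basis ℤ ℚ).constr_basis ℚ (fun h : ℤ => N ^ h.toNat) h
  rwa [AddMonoidAlgebra.basis_apply] at this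

theorem heightWeight_aeval_T (N : ℚ) (p : Polynomial ℚ) :
    heightWeight N (Polynomial.aeval (LaurentPolynomial.T 1) p) = p.eval N := by
  induction p using Polynomial.induction_on' with
  | add p q hp hq => rw [map_add, map_add, hp, hq, Polynomial.eval_add]
  | monomial k r =>
    rw [Polynomial.aeval_monomial, ← Algebra.smul_def, map_smul, LaurentPolynomial.T_pow,
      heightWeight_T]
    simp

theorem heightWeight_aeval_T_neg (N : ℚ) (p : Polynomial ℚ) :
    heightWeight N (Polynomial.aeval (LaurentPolynomial.T (-1)) p) = p.eval 1 := by
  induction p using Polynomial.induction_on' with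
  | add p q hp hq => rw [map_add, map_add, hp, hq, Polynomial.eval_add]
  | monomial k r =>
    rw [Polynomial.aeval_monomial, ← Algebra.smul_def, map_smul, LaurentPolynomial.T_pow,
      heightWeight_T]
    simp

/-- A linear functional, applied to the coefficients of a power series. -/
def PowerSeries.mapLinear {R : Type*} [CommRing R] [Algebra ℚ R] (φ : R →ₗ[ℚ] ℚ) :
    R⟦X⟧ →+ ℚ⟦X⟧ where
  toFun f := PowerSeries.mk fun n => φ (coeff n f)
  map_zero' := by ext; simp
  map_add' f g := by ext; simp

/-- A linear functional need not respect `ld`, but on the image of f it agrees with a ring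
homomorphism, which does. -/
theorem PowerSeries.mapLinear_ld_map {R : Type*} [CommRing R] [Algebra ℚ R] (φ : R →ₗ[ℚ] ℚ)
    {S : Type*} [CommRing S] (f : S →+* R) (e : S →+* ℚ) (h : ∀ p, φ (f p) = e p) {u : S⟦X⟧}
    (hu : constantCoeff u = 1) : mapLinear φ (ld (map f u)) = ld (map e u) := by
  rw [ld_map f hu, ld_map e hu]
  ext n
  simp [mapLinear, h]

/-! ### The quadratic equation for g -/

section gSeries

theorem constantCoeff_gSeries (N K : ℕ) : constantCoeff (gSeries N K) = 0 := by
  rw [gSeries, map_mul, map_sub, constantCoeff_seriesSqrt (by simp)]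
  simp

theorem gSeries_eq (N K : ℕ) : gSeries N K = C (1 / 2 : ℚ) *
    (1 + ((N : ℚ⟦X⟧) - (K : ℚ⟦X⟧)) * X ^ 2 - seriesSqrt
      ((1 + ((N : ℚ⟦X⟧) - (K : ℚ⟦X⟧)) * X ^ 2) ^ 2 - 4 * (N : ℚ⟦X⟧) * X ^ 2)) := rfl

theorem gSeries_sq (N K : ℕ) :
    gSeries N K ^ 2 = (1 + ((N : ℚ⟦X⟧) - (K : ℚ⟦X⟧)) * X ^ 2) * gSeries N K - (N : ℚ⟦X⟧) * X ^ 2 := by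
  have h1 := seriesSqrt_sq (f := (1 + ((N : ℚ⟦X⟧) - (K : ℚ⟦X⟧)) * X ^ 2) ^ 2 -
    4 * (N : ℚ⟦X⟧) * X ^ 2) (by simp)
  have h2 : (C (1 / 2 : ℚ) : ℚ⟦X⟧) * 2 = 1 := by
    rw [← map_ofNat (C (R := ℚ)) 2, ← map_mul]
    simp
  rw [gSeries_eq]
  set q := seriesSqrt ((1 + ((N : ℚ⟦X⟧) - (K : ℚ⟦X⟧)) * X ^ 2) ^ 2 - 4 * (N : ℚ⟦X⟧) * X ^ 2)
  set b : ℚ⟦X⟧ := 1 + ((N : ℚ⟦X⟧) - (K : ℚ⟦X⟧)) * X ^ 2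
  set d : ℚ⟦X⟧ := C (1 / 2 : ℚ)
  linear_combination d ^ 2 * h1 + (d * b * (b - q) - (N : ℚ⟦X⟧) * X ^ 2 * (2 * d + 1)) * h2

end gSeries

/-! ### From the transfer matrix to the zeta function -/

section main
variable {Γ : Type*} [DecidableEq Γ]

/-- The `0`-`1` matrix of `Ψ` over a ring. -/
def zeroOneMatrix (R : Type*) [CommRing R] (Ψ : Γ → Finset Γ) : Matrix Γ Γ R :=
  Matrix.of fun β α => if β ∈ Ψ α then 1 else 0

theorem prod_T {ι : Type*} (s : Finset ι) (f : ι → ℤ) :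
    ∏ i ∈ s, (LaurentPolynomial.T (f i) : LaurentPolynomial ℚ) =
      LaurentPolynomial.T (∑ i ∈ s, f i) := by
  classical
  induction s using Finset.induction_on with
  | empty => simp
  | insert a s ha ih => rw [Finset.prod_insert ha, Finset.sum_insert ha, ih, LaurentPolynomial.T_add]

/-- The transfer matrix of the skeletons of the points of the subshift. -/
def transferMatrix (Ψ : Γ → Finset Γ) : Matrix (Γ ⊕ Unit) (Γ ⊕ Unit) (LaurentPolynomial ℚ) :=
  (zeroOneMatrix _ Ψ).bordered (LaurentPolynomial.T (-1)) (LaurentPolynomial.T 1)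

open Classical in
theorem prod_transferMatrix (Ψ : Γ → Finset Γ) {n : ℕ} [NeZero n] (c : ZMod n → Γ ⊕ Unit) :
    ∏ i, transferMatrix Ψ (c i) (c (i + 1)) =
      if Allowed Ψ c then LaurentPolynomial.T (∑ r, skeletonSgn (c r)) else 0 := by
  split_ifs with h
  · rw [← prod_T]
    refine Finset.prod_congr rfl fun i _ => ?_
    have hi := h i
    rcases hc : c i with β | β <;> rcases hc' : c (i + 1) with α | α
    · simp [transferMatrix, Matrix.bordered, skeletonSgn, zeroOneMatrix, hi α β hc hc']
    all_goals simp [transferMatrix, Matrix.bordered, skeletonSgn]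
  · simp only [Allowed, not_forall] at h
    obtain ⟨i, α, β, h1, h2, h3⟩ := h
    refine Finset.prod_eq_zero (Finset.mem_univ i) ?_
    rw [h1, h2]
    simp [transferMatrix, Matrix.bordered, zeroOneMatrix, h3]

variable [Fintype Γ]

theorem heightWeight_trace [Nonempty Γ] (Ψ : Γ → Finset Γ) (m : ℕ) :
    heightWeight (Fintype.card Γ) (transferMatrix Ψ ^ (m + 1)).trace =
      ((dyckShiftRemoved Ψ ∩ Function.ptsOfPeriod
        (SymbolicDynamics.FullShift.shift (1 : ℤ)) (m + 1)).ncard : ℚ) := by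
  classical
  rw [ncard_periodic, Matrix.trace_pow_succ, map_sum, Nat.cast_sum]
  refine Finset.sum_congr rfl fun c _ => ?_
  have h := prod_transferMatrix Ψ (n := m + 1) c
  refine (congrArg _ h).trans ?_
  split_ifs
  · rw [heightWeight_T, Nat.cast_pow]
  · simp

theorem constantCoeff_shiftZeta {A : Type*} (Y : Set (ℤ → A)) :
    constantCoeff (shiftZeta Y) = 1 := by
  rw [shiftZeta]
  set P := PowerSeries.mk fun n : ℕ => if n = 0 then (0 : ℚ) else ((Y ∩ Function.ptsOfPeriod
    (SymbolicDynamics.FullShift.shift (1 : ℤ)) n).ncard : ℚ) / (n : ℚ)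
  have hP0 : constantCoeff P = 0 := by simp [P]
  have hP := HasSubst.of_constantCoeff_zero' hP0
  have h1 : constantCoeff ((PowerSeries.exp ℚ - 1).subst P : ℚ⟦X⟧) = 0 :=
    constantCoeff_subst_eq_zero hP0 _ (by simp)
  have h2 : (PowerSeries.exp ℚ - 1).subst P = (PowerSeries.exp ℚ).subst P - 1 := by
    rw [← coe_substAlgHom hP, map_sub, map_one]
  rw [h2, map_sub, map_one, sub_eq_zero] at h1
  exact h1

theorem ld_shiftZeta {A : Type*} (Y : Set (ℤ → A)) :
    ld (shiftZeta Y) = PowerSeries.mk fun m => ((Y ∩ Function.ptsOfPeriod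
      (SymbolicDynamics.FullShift.shift (1 : ℤ)) (m + 1)).ncard : ℚ) := by
  refine (eq_ld_of_mul (constantCoeff_shiftZeta Y) ?_).symm
  rw [shiftZeta, derivative_subst (HasSubst.of_constantCoeff_zero' (by simp)), derivative_exp,
    mul_comm]
  congr 1
  ext m
  rw [coeff_derivative, coeff_mk, coeff_mk, if_neg (Nat.succ_ne_zero m)]
  have : (m : ℚ) + 1 ≠ 0 := by positivity
  push_cast
  field_simp

/-- The conditions on c and a are what the factorization c(1 - aT)(1 - KaT⁻¹) requires: `hca`
matches the coefficients of T and T⁻¹, and `hcq` then matches the constant term. -/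
theorem ld_shiftZeta_dyckShiftRemoved [Nonempty Γ] (Ψ : Γ → Finset Γ) (K : ℕ)
    (hΨ : ∀ γ : Γ, (Ψ γ).card = K) {c a : ℚ⟦X⟧} (hc : constantCoeff c = 1) (hca : c * a = X)
    (hcq : c ^ 2 = (1 + ((K : ℚ⟦X⟧) - (Fintype.card Γ : ℚ⟦X⟧)) * X ^ 2) * c - (K : ℚ⟦X⟧) * X ^ 2) :
    ld (shiftZeta (dyckShiftRemoved Ψ)) + (ld (1 - (X : ℚ⟦X⟧) • transitionMatrix Ψ).det + ld c +
      ld (1 - a * (Fintype.card Γ : ℚ⟦X⟧)) + ld (1 - (K : ℚ⟦X⟧) * a)) = ld (1 - (K : ℚ⟦X⟧) * X) := by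
  set N := Fintype.card Γ
  let φ := heightWeight N
  -- `f₁` and `f₂` read the polynomial variable as T and as T⁻¹. Composed with φ they become the
  -- evaluations at N and at 1, since every negative height has weight 1.
  let f₁ : Polynomial ℚ →+* LaurentPolynomial ℚ :=
    (Polynomial.aeval (LaurentPolynomial.T 1 : LaurentPolynomial ℚ)).toRingHom
  let f₂ : Polynomial ℚ →+* LaurentPolynomial ℚ :=
    (Polynomial.aeval (LaurentPolynomial.T (-1) : LaurentPolynomial ℚ)).toRingHom
  let e₁ := Polynomial.evalRingHom (N : ℚ)
  let e₂ := Polynomial.evalRingHom (1 : ℚ)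
  have h₁ : ∀ p, φ (f₁ p) = e₁ p := heightWeight_aeval_T _
  have h₂ : ∀ p, φ (f₂ p) = e₂ p := heightWeight_aeval_T_neg _
  let j : ℚ⟦X⟧ →+* (Polynomial ℚ)⟦X⟧ := map Polynomial.C
  let t : (Polynomial ℚ)⟦X⟧ := C Polynomial.X
  have hj : ∀ u, constantCoeff (j u) = Polynomial.C (constantCoeff u) := fun u => by
    rw [← coeff_zero_eq_constantCoeff_apply, coeff_map, coeff_zero_eq_constantCoeff_apply]
  have ha : constantCoeff a = 0 := by
    have := congrArg constantCoeff hca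
    simpa [hc] using this
  let A₁ : Matrix Γ Γ (Polynomial ℚ) := (Polynomial.X : Polynomial ℚ) • zeroOneMatrix _ Ψ
  let D := (transferMatrix Ψ).oneSubX.det
  have hsum : ∀ α, ∑ β, zeroOneMatrix (LaurentPolynomial ℚ) Ψ β α = K := fun α => by
    simp [zeroOneMatrix, hΨ]
  have hdet := Matrix.det_oneSubX_bordered (zeroOneMatrix (LaurentPolynomial ℚ) Ψ)
    (LaurentPolynomial.T (-1)) (LaurentPolynomial.T 1) (by
      rw [← LaurentPolynomial.T_add, neg_add_cancel, LaurentPolynomial.T_zero]) K hsum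
  have hf₁j : ∀ u, map f₁ (j u) = map (algebraMap ℚ (LaurentPolynomial ℚ)) u := fun u => by
    ext n : 1
    rw [coeff_map, coeff_map, coeff_map]
    exact Polynomial.aeval_C _ _
  have hf₂j : ∀ u, map f₂ (j u) = map (algebraMap ℚ (LaurentPolynomial ℚ)) u := fun u => by
    ext n : 1
    rw [coeff_map, coeff_map, coeff_map]
    exact Polynomial.aeval_C _ _
  have he₁j : ∀ u, map e₁ (j u) = u := fun u => by
    ext n : 1
    rw [coeff_map, coeff_map]
    exact Polynomial.eval_C
  have he₂j : ∀ u, map e₂ (j u) = u := fun u => by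
    ext n : 1
    rw [coeff_map, coeff_map]
    exact Polynomial.eval_C
  have hfac : map f₂ (1 - j ((K : ℚ⟦X⟧) * X) * t) * D = map f₂ A₁.oneSubX.det *
      (map f₁ (j c) * map f₁ (1 - j a * t) * map f₂ (1 - j ((K : ℚ⟦X⟧) * a) * t)) := by
    have ht₁ : map f₁ t = C (LaurentPolynomial.T 1) := by simp [t, f₁]
    have ht₂ : map f₂ t = C (LaurentPolynomial.T (-1)) := by simp [t, f₂]
    have hA₂ : map f₂ A₁.oneSubX.det =
        ((LaurentPolynomial.T (-1) : LaurentPolynomial ℚ) • zeroOneMatrix (LaurentPolynomial ℚ) Ψ).oneSubX.det := by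
      rw [Matrix.map_det_oneSubX]
      congr 2
      ext β α : 2
      by_cases h : β ∈ Ψ α <;> simp [A₁, zeroOneMatrix, h, f₂]
    rw [hA₂]
    simp only [map_sub (map _), map_mul (map _), map_one (map _), ht₁, ht₂, hf₁j, hf₂j]
    have hst : (C (LaurentPolynomial.T (-1)) * C (LaurentPolynomial.T 1) :
        (LaurentPolynomial ℚ)⟦X⟧) = 1 := by
      rw [← map_mul, ← LaurentPolynomial.T_add, neg_add_cancel, LaurentPolynomial.T_zero, map_one]
    have hca' := congrArg (map (algebraMap ℚ (LaurentPolynomial ℚ))) hca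
    -- This is the quadratic equation divided by c, as ca = X.
    have hcq₁ : c + (K : ℚ⟦X⟧) * X * a = 1 + ((K : ℚ⟦X⟧) - (N : ℚ⟦X⟧)) * X ^ 2 := by
      have hc0 : c ≠ 0 := fun h => by simp [h] at hc
      refine mul_left_cancel₀ hc0 ?_
      linear_combination hcq + (K : ℚ⟦X⟧) * X * hca
    have hcq' := congrArg (map (algebraMap ℚ (LaurentPolynomial ℚ))) hcq₁
    simp only [map_sub, map_mul, map_one, map_pow, map_natCast, map_add, map_X] at hca' hcq' hdet ⊢
    change _ * D = _ at hdet
    set s' : (LaurentPolynomial ℚ)⟦X⟧ := C (LaurentPolynomial.T (-1))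
    set t' : (LaurentPolynomial ℚ)⟦X⟧ := C (LaurentPolynomial.T 1)
    set d := ((LaurentPolynomial.T (-1) : LaurentPolynomial ℚ) • zeroOneMatrix (LaurentPolynomial ℚ) Ψ).oneSubX.det
    set a' := map (algebraMap ℚ (LaurentPolynomial ℚ)) a
    set c' := map (algebraMap ℚ (LaurentPolynomial ℚ)) c
    have h : c' * (1 - a' * t') * (1 - (K : (LaurentPolynomial ℚ)⟦X⟧) * a' * s') =
        (1 - X * t') * (1 - X * ((K : (LaurentPolynomial ℚ)⟦X⟧) * s')) -
          (N : (LaurentPolynomial ℚ)⟦X⟧) * X ^ 2 := by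
      linear_combination hcq' + ((K : (LaurentPolynomial ℚ)⟦X⟧) * a' - t' -
        (K : (LaurentPolynomial ℚ)⟦X⟧) * s') * hca' +
        (K : (LaurentPolynomial ℚ)⟦X⟧) * (c' * a' ^ 2 - X ^ 2) * hst
    rw [h]
    linear_combination hdet
  have hu₀ : constantCoeff (1 - j ((K : ℚ⟦X⟧) * X) * t) = 1 := by simp [hj]
  have hu₁ : constantCoeff (1 - j a * t) = 1 := by simp [hj, ha]
  have hu₂ : constantCoeff (1 - j ((K : ℚ⟦X⟧) * a) * t) = 1 := by simp [hj, ha]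
  have hjc : constantCoeff (j c) = 1 := by simp [hj, hc]
  have hA : constantCoeff A₁.oneSubX.det = 1 := Matrix.constantCoeff_det_oneSubX _
  have hD : constantCoeff D = 1 := Matrix.constantCoeff_det_oneSubX _
  have hmap : ∀ (f : Polynomial ℚ →+* LaurentPolynomial ℚ) {u : (Polynomial ℚ)⟦X⟧},
      constantCoeff u = 1 → constantCoeff (map f u) = 1 := fun f u hu => by
    rw [← coeff_zero_eq_constantCoeff_apply, coeff_map, coeff_zero_eq_constantCoeff_apply, hu,
      map_one]
  have hmul : ∀ {u v : (LaurentPolynomial ℚ)⟦X⟧}, constantCoeff u = 1 → constantCoeff v = 1 →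
      constantCoeff (u * v) = 1 := fun hu hv => by rw [map_mul, hu, hv, mul_one]
  -- The logarithmic derivative turns the product into a sum, so φ can be evaluated factor by
  -- factor.
  have hld := congrArg (fun u => mapLinear φ (ld u)) hfac
  rw [ld_mul (hmap _ hu₀) hD,
    ld_mul (hmap _ hA) (hmul (hmul (hmap _ hjc) (hmap _ hu₁)) (hmap _ hu₂)),
    ld_mul (hmul (hmap _ hjc) (hmap _ hu₁)) (hmap _ hu₂), ld_mul (hmap _ hjc) (hmap _ hu₁)] at hld
  simp only [map_add] at hld
  rw [mapLinear_ld_map φ f₂ e₂ h₂ hu₀, mapLinear_ld_map φ f₂ e₂ h₂ hA,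
    mapLinear_ld_map φ f₂ e₂ h₂ hu₂, mapLinear_ld_map φ f₁ e₁ h₁ hjc,
    mapLinear_ld_map φ f₁ e₁ h₁ hu₁] at hld
  have hP : ld (shiftZeta (dyckShiftRemoved Ψ)) = - mapLinear φ (ld D) := by
    rw [ld_shiftZeta, ← map_neg, ← Matrix.trace_pow_series]
    ext m
    simp only [mapLinear, AddMonoidHom.coe_mk, ZeroHom.coe_mk, coeff_mk]
    exact (heightWeight_trace Ψ m).symm
  have hA₁ : map e₂ A₁.oneSubX.det = (1 - (X : ℚ⟦X⟧) • transitionMatrix Ψ).det := by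
    rw [Matrix.map_det_oneSubX, Matrix.oneSubX]
    congr 3
    ext β α : 2
    by_cases h : β ∈ Ψ α <;> simp [A₁, zeroOneMatrix, transitionMatrix, h, e₂]
  have ht₁ : map e₁ t = (N : ℚ⟦X⟧) := by simp [t, e₁]
  have ht₂ : map e₂ t = 1 := by simp [t, e₂]
  rw [hA₁, he₁j] at hld
  simp only [map_sub (map _), map_mul (map _), map_one (map _), ht₁, ht₂, he₁j, he₂j, mul_one] at hld
  rw [hP]
  linear_combination -hld

end main

end

/-- The denominator on the right-hand side has constant coefficient `1`, so that its inverse is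
its true inverse in the ring of formal power series. -/
theorem theorem4p9 {Γ : Type*} [Fintype Γ] [DecidableEq Γ] [Nontrivial Γ]
    (Ψ : Γ → Finset Γ) (K : ℕ) (hK : 1 ≤ K) (hKN : K ≤ Fintype.card Γ)
    (hΨ : ∀ γ : Γ, (Ψ γ).card = K) :
    shiftZeta (dyckShiftRemoved Ψ) =
      (1 - (K : ℚ⟦X⟧) * X) * (1 - gSeries (Fintype.card Γ) K) *
        ((1 - (X : ℚ⟦X⟧) • transitionMatrix Ψ).det *
          (1 - (Fintype.card Γ : ℚ⟦X⟧) * X - gSeries (Fintype.card Γ) K) *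
          (1 - (K : ℚ⟦X⟧) * X - gSeries (Fintype.card Γ) K))⁻¹ := by
  set N := Fintype.card Γ
  set g := gSeries N K
  have hg : constantCoeff g = 0 := constantCoeff_gSeries N K
  have hgq := gSeries_sq N K
  have hc : constantCoeff (1 - g) = 1 := by simp [hg]
  have hca : (1 - g) * ((1 - g)⁻¹ * X) = X := by
    rw [← mul_assoc, PowerSeries.mul_inv_cancel _ (by simp [hg]), one_mul]
  set a := (1 - g)⁻¹ * X
  have ha : constantCoeff a = 0 := by simp [a]
  -- Substituting g = 1 - c in the equation of g exchanges N and K, which gives the equation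
  -- required of c.
  have key := ld_shiftZeta_dyckShiftRemoved Ψ K hΨ hc hca (by
    linear_combination hgq)
  have h1 : 1 - (N : ℚ⟦X⟧) * X - g = (1 - g) * (1 - a * (N : ℚ⟦X⟧)) := by linear_combination (N : ℚ⟦X⟧) * hca
  have h2 : 1 - (K : ℚ⟦X⟧) * X - g = (1 - g) * (1 - (K : ℚ⟦X⟧) * a) := by linear_combination (K : ℚ⟦X⟧) * hca
  set d := (1 - (X : ℚ⟦X⟧) • transitionMatrix Ψ).det
  have hd : constantCoeff d = 1 := by
    simp only [d, RingHom.map_det]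
    rw [show (constantCoeff (R := ℚ)).mapMatrix (1 - (X : ℚ⟦X⟧) • transitionMatrix Ψ) = 1 from ?_,
      Matrix.det_one]
    ext i j
    rcases eq_or_ne i j with rfl | hij
    · simp
    · simp [hij]
  set Den := d * (1 - (N : ℚ⟦X⟧) * X - g) * (1 - (K : ℚ⟦X⟧) * X - g)
  have hDen : constantCoeff Den = 1 := by simp [Den, hd, hg]
  have hz := constantCoeff_shiftZeta (dyckShiftRemoved Ψ)
  have hc₁ : constantCoeff (1 - a * (N : ℚ⟦X⟧)) = 1 := by simp [ha]
  have hc₂ : constantCoeff (1 - (K : ℚ⟦X⟧) * a) = 1 := by simp [ha]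
  have hK' : constantCoeff (1 - (K : ℚ⟦X⟧) * X) = 1 := by simp
  rw [PowerSeries.eq_mul_inv_iff_mul_eq (by simp [hDen])]
  -- With denominators cleared, both sides have constant coefficient 1. The last two factors of
  -- `Den` each contribute a factor c, one of which cancels against the numerator.
  refine eq_of_ld_eq (by simp [hz, hDen]) (by simp [hc]) ?_
  rw [ld_mul hz hDen, ld_mul hK' hc, ← key]
  simp only [Den, h1, h2]
  rw [ld_mul (by simp [hd, hg, ha]) (by simp [hg, ha]), ld_mul hd (by simp [hg, ha]),
    ld_mul hc hc₁, ld_mul hc hc₂]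
  ring
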